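/- Let $\varepsilon>0$ and let $\lambda:[0,\infty)\to[0,\infty)$ be measurable. A 1-D shotgun cellular system (SCS) with base station (BS) density $\lambda$ consists of BSs whose distances $R_i$ from a mobile station at the origin form a Poisson point process on $[0,\infty)$ with intensity function $\lambda$, together with nonnegative random shadow fading factors $\Psi_i$ and transmission powers $K_i$ such that the pairs $(\Psi_i,K_i)$ are i.i.d. across the BSs and independent of the BS distances ($\Psi_i$ and $K_i$ of the same BS may be dependent). The power received from BS $i$ is $K_i\Psi_iR_i^{-\varepsilon}$, the serving BS $S$ is the one with the strongest received power, and $$\frac CI=\frac{K_S\Psi_SR_S^{-\varepsilon}}{\sum_{i\ne S}K_i\Psi_iR_i^{-\varepsilon}}\in[0,\infty],$$ with the value $\infty$ if exactly one BS has positive received power, and $0$ if no BS has positive received power or no strongest one exists. Let $(\Psi,K)$ have the same distribution as the $(\Psi_i,K_i)$ and suppose that the expectation $$\bar\lambda(r)=\mathbb E_{\Psi,K}\left[(\Psi K)^{1/\varepsilon}\,\lambda\left(r(\Psi K)^{1/\varepsilon}\right)\right]$$ converges (is finite) for almost every $r\ge 0$. Then, for the $C/I$ analysis, the SCS with density $\lambda$,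 fadings $\Psi_i$ and powers $K_i$ is equivalent to the SCS with density $\bar\lambda$ in which all fading factors and powers equal $1$: the distances $R_i(\Psi_iK_i)^{-1/\varepsilon}$ (BSs with $\Psi_iK_i=0$ being discarded) form an SCS with density $\bar\lambda$ and unit fadings and powers, and $C/I$ in the original SCS has the same distribution as $C/I$ in any SCS with density $\bar\lambda$ and unit fadings and powers. -/

import Mathlib

open MeasureTheory ProbabilityTheory Set Function
open scoped ENNReal

namespace ShotgunCellular

variable {Ω : Type*} [MeasurableSpace Ω]

/-- The number of base stations (BSs) whose distance from the origin lies in `B`. The distances are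
listed by a sequence `R` with values in `[0, ∞]`; the value `∞` means that the index carries no BS,
so that finite and infinite systems are both covered. The list is not required to be sorted. -/
noncomputable def bsCount (R : ℕ → Ω → ℝ≥0∞) (B : Set ℝ) (ω : Ω) : ℕ∞ :=
  {i : ℕ | ∃ r ∈ B, 0 ≤ r ∧ R i ω = ENNReal.ofReal r}.encard

/-- The mean measure on `[0, ∞)` with density `lam` with respect to Lebesgue measure. -/
noncomputable def meanMeasure (lam : ℝ → ℝ) : Measure ℝ :=
  (volume.restrict (Ici 0)).withDensity fun r => ENNReal.ofReal (lam r)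

/-- `R` lists the points of a (nonhomogeneous) Poisson point process on `[0, ∞)` with intensity
function `lam`: the number of points in `B` is Poisson with mean `∫_B lam`, and the numbers of
points in disjoint sets are independent. As `lam` is real valued, the mean measure is sigma-finite,
so the sets of finite mean measure determine the counts of all others. -/
structure IsPoissonProcess (P : Measure Ω) (lam : ℝ → ℝ) (R : ℕ → Ω → ℝ≥0∞) : Prop where
  measurable : ∀ i, Measurable (R i)
  count_law : ∀ B : Set ℝ, MeasurableSet B → meanMeasure lam B ≠ ∞ →
    ∀ n : ℕ, P {ω | bsCount R B ω = n} = poissonMeasure (meanMeasure lam B).toNNReal {n}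
  count_indep : ∀ (m : ℕ) (B : Fin m → Set ℝ), (∀ j, MeasurableSet (B j)) →
    (∀ j, meanMeasure lam (B j) ≠ ∞) → Pairwise (Disjoint on B) →
    iIndepFun (fun j => bsCount R (B j)) P

/-- A 1-D shotgun cellular system with BS density function `lam`, BS distances `R i`, shadow fading
factors `Ψ i` and transmission powers `K i`: the BSs form a Poisson point process with intensity
function `lam`, and the pairs `(Ψ i, K i)` are nonnegative, independent and identically distributed
across the BSs, and independent of the BS distances. (`Ψ i` and `K i` may depend on each other.) -/
structure IsSCS (P : Measure Ω) (lam : ℝ → ℝ) (R : ℕ → Ω → ℝ≥0∞) (Ψ K : ℕ → Ω → ℝ) : Prop where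
  poisson : IsPoissonProcess P lam R
  measurable_fading : ∀ i, Measurable (Ψ i)
  measurable_power : ∀ i, Measurable (K i)
  fading_nonneg : ∀ i, ∀ᵐ ω ∂P, 0 ≤ Ψ i ω
  power_nonneg : ∀ i, ∀ᵐ ω ∂P, 0 ≤ K i ω
  indep : iIndepFun (fun (i : ℕ) (ω : Ω) => (Ψ i ω, K i ω)) P
  identDistrib : ∀ i,
    IdentDistrib (fun ω => (Ψ i ω, K i ω)) (fun ω => (Ψ 0 ω, K 0 ω)) P P
  indep_distances :
    IndepFun (fun (ω : Ω) (i : ℕ) => R i ω) (fun (ω : Ω) (i : ℕ) => (Ψ i ω, K i ω)) P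

/-- The power `K i * Ψ i * R i ^ (-ε)` received at the origin from BS `i` (zero if the index `i`
carries no BS). -/
noncomputable def receivedPower (ε : ℝ) (R : ℕ → Ω → ℝ≥0∞) (Ψ K : ℕ → Ω → ℝ) (i : ℕ) (ω : Ω) :
    ℝ≥0∞ :=
  ENNReal.ofReal (K i ω * Ψ i ω) * R i ω ^ (-ε)

open Classical in
/-- The ratio of the largest term `p s` of a family of powers to the sum of all other terms. It does
not matter which index is chosen if several attain the maximum. The ratio is `0` if the other powers
have an infinite sum, `∞` if they all vanish while `p s` does not, and it is `0` by convention if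
all powers vanish or if there is no largest one. -/
noncomputable def maxToRest (p : ℕ → ℝ≥0∞) : ℝ≥0∞ :=
  if h : ∃ s, ∀ i, p i ≤ p s then p h.choose / ∑' i, (if i = h.choose then 0 else p i) else 0

/-- The carrier-to-interference ratio at the origin, where the serving BS is the one with the
strongest received power and all other BSs interfere. -/
noncomputable def carrierToInterference (ε : ℝ) (R : ℕ → Ω → ℝ≥0∞) (Ψ K : ℕ → Ω → ℝ) (ω : Ω) :
    ℝ≥0∞ :=
  maxToRest fun i => receivedPower ε R Ψ K i ω

/-- The integrand `(ΨK)^(1/ε) * lam (r * (ΨK)^(1/ε))` of the modified BS density. -/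
noncomputable def densityIntegrand (ε : ℝ) (lam : ℝ → ℝ) (Ψ K : Ω → ℝ) (r : ℝ) (ω : Ω) : ℝ :=
  (Ψ ω * K ω) ^ (1 / ε) * lam (r * (Ψ ω * K ω) ^ (1 / ε))

/-- The modified BS density function `r ↦ E[(ΨK)^(1/ε) * lam (r * (ΨK)^(1/ε))]`. -/
noncomputable def modifiedDensity (P : Measure Ω) (ε : ℝ) (lam : ℝ → ℝ) (Ψ K : Ω → ℝ) (r : ℝ) : ℝ :=
  ∫ ω, densityIntegrand ε lam Ψ K r ω ∂P

end ShotgunCellular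

/-! A Poisson process with mean measure Λ is characterised by its Laplace functional E exp(-∑
f(R_i)) = exp(-∫ (1 - e^{-f}) dΛ). Averaging over the independent marks shows that the rescaled
distances R_i (Ψ_i K_i)^{-1/ε} have the functional exp(-∫ E[1 - exp(-f(r (ΨK)^{-1/ε}))] λ(r) dr).
The substitution r = u (ΨK)^{1/ε} and Tonelli turn λ into the modified density
(`IsSCS.hasPoissonLaplace_scaled`). Passing back from the functional to Poisson, independent counts
(`HasPoissonLaplace.isPoisson`) rests on the moment problem on a cube, applied to the variables
exp(-count).

Rescaling almost surely preserves every received power, so C/I may be computed in the rescaled unit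
system. There it is a function of the sum and the supremum of the powers (`maxToRest_eq`). The joint
law of these two depends on the density alone, because test functions with value ∞ let the Laplace
functional see the supremum too (`HasPoissonLaplace.map_pointSum_pointSup_eq`). Since exp(-∞) = 0,
infinite sums need no separate treatment. -/

namespace ShotgunCellular

/-! ### The map `x ↦ exp (-x)` on `[0, ∞]` -/

/-- The decreasing bijection `x ↦ exp (-x)` of `[0, ∞]` onto `[0, 1]`. -/
noncomputable def expNeg (x : ℝ≥0∞) : ℝ≥0∞ := EReal.exp (-(x : EReal))

@[simp] lemma expNeg_zero : expNeg 0 = 1 := by simp [expNeg]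

@[simp] lemma expNeg_top : expNeg ∞ = 0 := by simp [expNeg]

lemma continuous_expNeg : Continuous expNeg :=
  ENNReal.continuous_exp.comp (continuous_neg.comp continuous_coe_ennreal_ereal)

@[fun_prop]
lemma measurable_expNeg : Measurable expNeg := continuous_expNeg.measurable

lemma expNeg_add (x y : ℝ≥0∞) : expNeg (x + y) = expNeg x * expNeg y := by
  rw [expNeg, expNeg, expNeg, ← EReal.exp_add, EReal.coe_ennreal_add, EReal.neg_add,
    sub_eq_add_neg]
  · left; simp
  · right; simp

lemma expNeg_sum {ι : Type*} (s : Finset ι) (f : ι → ℝ≥0∞) :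
    expNeg (∑ i ∈ s, f i) = ∏ i ∈ s, expNeg (f i) := by
  classical
  induction s using Finset.induction_on with
  | empty => simp
  | insert a s ha ih => rw [Finset.sum_insert ha, Finset.prod_insert ha, expNeg_add, ih]

lemma expNeg_natCast_mul (n : ℕ) (x : ℝ≥0∞) : expNeg (n * x) = expNeg x ^ n := by
  have := expNeg_sum (Finset.range n) fun _ => x
  simpa using this

lemma expNeg_strictAnti : StrictAnti expNeg := fun _ _ h =>
  EReal.exp_strictMono (EReal.neg_lt_neg_iff.2 (EReal.coe_ennreal_lt_coe_ennreal_iff.2 h))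

lemma expNeg_le_one (x : ℝ≥0∞) : expNeg x ≤ 1 := by
  simpa using expNeg_strictAnti.antitone (zero_le (a := x))

lemma expNeg_ne_top (x : ℝ≥0∞) : expNeg x ≠ ∞ :=
  ((expNeg_le_one x).trans_lt ENNReal.one_lt_top).ne

lemma expNeg_ofReal {x : ℝ} (hx : 0 ≤ x) :
    expNeg (ENNReal.ofReal x) = ENNReal.ofReal (Real.exp (-x)) := by
  rw [expNeg, EReal.coe_ennreal_ofReal, max_eq_left hx, ← EReal.coe_neg, EReal.exp_coe]

/-- The inverse `y ↦ -log y` of `expNeg`. -/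
noncomputable def negLog (y : ℝ≥0∞) : ℝ≥0∞ := (-ENNReal.log y).toENNReal

@[fun_prop]
lemma measurable_negLog : Measurable negLog := by
  unfold negLog
  exact (ENNReal.continuous_log.measurable.neg).ereal_toENNReal

lemma negLog_expNeg (x : ℝ≥0∞) : negLog (expNeg x) = x := by
  simp [negLog, expNeg]

lemma expNeg_negLog {y : ℝ≥0∞} (hy : y ≤ 1) : expNeg (negLog y) = y := by
  have h : 0 ≤ -ENNReal.log y := by
    rw [EReal.neg_nonneg]
    simpa using ENNReal.log_monotone hy
  rw [expNeg, negLog, EReal.coe_toENNReal h, neg_neg, ENNReal.exp_log]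

lemma tendsto_prod_expNeg (f : ℕ → ℝ≥0∞) :
    Filter.Tendsto (fun n => ∏ i ∈ Finset.range n, expNeg (f i)) Filter.atTop
      (nhds (expNeg (∑' i, f i))) := by
  simp_rw [← expNeg_sum]
  exact (continuous_expNeg.tendsto _).comp (ENNReal.tendsto_nat_tsum f)

/-- `expNeg` with values in the unit interval. -/
noncomputable def expNegUnit (x : ℝ≥0∞) : unitInterval :=
  ⟨(expNeg x).toReal, ENNReal.toReal_nonneg,
    ENNReal.toReal_le_of_le_ofReal zero_le_one (by simpa using expNeg_le_one x)⟩

lemma ofReal_expNegUnit (x : ℝ≥0∞) : ENNReal.ofReal (expNegUnit x) = expNeg x :=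
  ENNReal.ofReal_toReal (expNeg_ne_top x)

@[fun_prop]
lemma measurable_expNegUnit : Measurable expNegUnit :=
  Measurable.subtype_mk (measurable_expNeg.ennreal_toReal)

lemma negLog_expNegUnit (x : ℝ≥0∞) : negLog (ENNReal.ofReal (expNegUnit x)) = x := by
  rw [ofReal_expNegUnit, negLog_expNeg]

lemma expNegUnit_injective : Injective expNegUnit := fun a b e => by
  rw [← negLog_expNegUnit a, e, negLog_expNegUnit]

/-! ### Measures on a cube are determined by their moments -/

/-- Finite measures on a cube with the same moments agree. -/
lemma ext_of_lintegral_prod_pow {ι : Type*} [Fintype ι] {μ ν : Measure (ι → unitInterval)}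
    [IsFiniteMeasure μ] [IsFiniteMeasure ν]
    (h : ∀ n : ι → ℕ, ∫⁻ x, ∏ i, ENNReal.ofReal (x i) ^ n i ∂μ
      = ∫⁻ x, ∏ i, ENNReal.ofReal (x i) ^ n i ∂ν) : μ = ν := by
  let c : ι → BoundedContinuousFunction (ι → unitInterval) ℝ := fun i =>
    BoundedContinuousFunction.mkOfCompact ⟨fun x => (x i : ℝ), by fun_prop⟩
  -- Polynomials in the coordinates separate points, so their integrals determine a finite measure
  -- on the cube. On monomials these integrals are the moments.
  let A : StarSubalgebra ℝ (BoundedContinuousFunction (ι → unitInterval) ℝ) :=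
    { (MvPolynomial.aeval (R := ℝ) c).range with
      star_mem' := fun {a} ha => by
        have : star a = a := by ext x; simp
        rw [this]; exact ha }
  have hc : ∀ i, c i ∈ A := fun i => ⟨MvPolynomial.X i, by simp⟩
  have key : ∀ n : ι →₀ ℕ, ∀ ρ : Measure (ι → unitInterval),
      ∫ x, ∏ i, (x i : ℝ) ^ n i ∂ρ
        = (∫⁻ x, ∏ i, ENNReal.ofReal (x i) ^ n i ∂ρ).toReal := fun n ρ => by
    rw [integral_eq_lintegral_of_nonneg_ae
      (ae_of_all _ fun x => Finset.prod_nonneg fun i _ => pow_nonneg (x i).2.1 _)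
      (Continuous.aestronglyMeasurable (by fun_prop))]
    congr 2 with x
    rw [ENNReal.ofReal_prod_of_nonneg fun i _ => pow_nonneg (x i).2.1 _]
    exact Finset.prod_congr rfl fun i _ => ENNReal.ofReal_pow (x i).2.1 _
  refine ext_of_forall_mem_subalgebra_integral_eq_of_polish (𝕜 := ℝ) (A := A) ?_ ?_
  · intro x y hxy
    obtain ⟨i, hi⟩ := Function.ne_iff.1 hxy
    exact ⟨_, ⟨_, ⟨c i, hc i, rfl⟩, rfl⟩, fun e => hi (Subtype.ext e)⟩
  · rintro g ⟨p, rfl⟩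
    induction p using MvPolynomial.induction_on' with
    | monomial n a =>
      have e : ∀ x, (MvPolynomial.aeval (R := ℝ) c (MvPolynomial.monomial n a)) x
          = a * ∏ i, (x i : ℝ) ^ n i := fun x => by
        rw [MvPolynomial.aeval_monomial, Finsupp.prod_fintype _ _ (by simp)]
        simp [c, Algebra.algebraMap_eq_smul_one]
      change ∫ x, (MvPolynomial.aeval (R := ℝ) c (MvPolynomial.monomial n a)) x ∂μ
        = ∫ x, (MvPolynomial.aeval (R := ℝ) c (MvPolynomial.monomial n a)) x ∂ν
      simp_rw [e, integral_const_mul, key, h]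
    | add p q hp hq =>
      simp only [map_add, BoundedContinuousFunction.coe_add, Pi.add_apply] at *
      rw [integral_add (BoundedContinuousFunction.integrable _ _)
        (BoundedContinuousFunction.integrable _ _),
        integral_add (BoundedContinuousFunction.integrable _ _)
        (BoundedContinuousFunction.integrable _ _), hp, hq]

/-- Finite measures on the unit interval with the same moments agree. -/
lemma ext_of_lintegral_pow {μ ν : Measure unitInterval} [IsFiniteMeasure μ] [IsFiniteMeasure ν]
    (h : ∀ n : ℕ, ∫⁻ x, ENNReal.ofReal x ^ n ∂μ = ∫⁻ x, ENNReal.ofReal x ^ n ∂ν) : μ = ν := by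
  have hm : Measurable fun (x : unitInterval) (_ : Unit) => x := by fun_prop
  have : μ.map (fun x (_ : Unit) => x) = ν.map (fun x (_ : Unit) => x) := by
    refine ext_of_lintegral_prod_pow fun n => ?_
    rw [lintegral_map (by fun_prop) hm, lintegral_map (by fun_prop) hm]
    simpa using h (n ())
  have h2 := congrArg (Measure.map fun x : Unit → unitInterval => x ()) this
  rw [Measure.map_map (by fun_prop) hm, Measure.map_map (by fun_prop) hm] at h2
  simpa [Function.comp_def] using h2

/-- The Laplace transform of the Poisson distribution. -/
lemma lintegral_expNeg_poissonMeasure (μ : NNReal) (s : ℝ≥0∞) :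
    ∫⁻ n, expNeg s ^ n ∂(poissonMeasure μ) = expNeg (μ * (1 - expNeg s)) := by
  obtain ⟨z, hz⟩ : ∃ z : ℝ, z = (expNeg s).toReal := ⟨_, rfl⟩
  have hz0 : 0 ≤ z := hz ▸ ENNReal.toReal_nonneg
  have hs : expNeg s = ENNReal.ofReal z := by rw [hz, ENNReal.ofReal_toReal (expNeg_ne_top s)]
  have hz1 : z ≤ 1 := by
    have := expNeg_le_one s
    rwa [hs, ENNReal.ofReal_le_one] at this
  rw [lintegral_countable', hs]
  have h1 : ∀ n : ℕ, ENNReal.ofReal z ^ n * poissonMeasure μ {n}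
      = ENNReal.ofReal (Real.exp (-μ) * ((μ * z) ^ n / n.factorial)) := fun n => by
    rw [poissonMeasure_singleton, ← ENNReal.ofReal_pow hz0, ← ENNReal.ofReal_mul (by positivity)]
    congr 1
    rw [mul_pow]; ring
  have hsum := (NormedSpace.expSeries_div_hasSum_exp ((μ : ℝ) * z)).mul_left (Real.exp (-μ))
  simp_rw [h1]
  rw [← ENNReal.ofReal_tsum_of_nonneg (fun n => by positivity) hsum.summable, hsum.tsum_eq,
    ← Real.exp_eq_exp_ℝ, ← Real.exp_add, ← ENNReal.ofReal_one, ← ENNReal.ofReal_sub _ hz0,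
    ← ENNReal.ofReal_coe_nnreal, ← ENNReal.ofReal_mul μ.coe_nonneg,
    expNeg_ofReal (mul_nonneg μ.coe_nonneg (by linarith))]
  congr 2
  ring

section

variable {Ω : Type*}

/-! ### Sums over the points of a process -/

/-- The function `f` on `[0, ∞)` extended by zero to the mark `∞` of an index without point. -/
noncomputable def atPoint (f : ℝ → ℝ≥0∞) (x : ℝ≥0∞) : ℝ≥0∞ := if x = ∞ then 0 else f x.toReal

/-- The sum of `f` over the points listed by `R`. -/
noncomputable def pointSum (f : ℝ → ℝ≥0∞) (R : ℕ → Ω → ℝ≥0∞) (ω : Ω) : ℝ≥0∞ :=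
  ∑' i, atPoint f (R i ω)

@[simp] lemma atPoint_top (f : ℝ → ℝ≥0∞) : atPoint f ∞ = 0 := by simp [atPoint]

lemma measurable_atPoint {f : ℝ → ℝ≥0∞} (hf : Measurable f) : Measurable (atPoint f) :=
  Measurable.ite (measurableSet_singleton _) measurable_const (hf.comp ENNReal.measurable_toReal)

lemma measurable_pointSum [MeasurableSpace Ω] {f : ℝ → ℝ≥0∞} (hf : Measurable f)
    {R : ℕ → Ω → ℝ≥0∞}
    (hR : ∀ i, Measurable (R i)) : Measurable (pointSum f R) :=
  Measurable.tsum fun i => (measurable_atPoint hf).comp (hR i)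

lemma atPoint_indicator (B : Set ℝ) (x : ℝ≥0∞)
    [Decidable (∃ r ∈ B, 0 ≤ r ∧ x = ENNReal.ofReal r)] :
    atPoint (B.indicator 1) x = if ∃ r ∈ B, 0 ≤ r ∧ x = ENNReal.ofReal r then 1 else 0 := by
  by_cases hx : x = ∞
  · rw [if_neg]
    · simp [hx]
    · rintro ⟨r, -, -, h⟩
      exact ENNReal.ofReal_ne_top (h.symm.trans hx)
  · rw [atPoint, if_neg hx]
    by_cases hB : x.toReal ∈ B
    · rw [if_pos ⟨_, hB, ENNReal.toReal_nonneg, (ENNReal.ofReal_toReal hx).symm⟩,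
        indicator_of_mem hB, Pi.one_apply]
    · rw [if_neg, indicator_of_notMem hB]
      rintro ⟨r, hr, h0, rfl⟩
      exact hB (by rwa [ENNReal.toReal_ofReal h0])

lemma coe_bsCount (R : ℕ → Ω → ℝ≥0∞) (B : Set ℝ) (ω : Ω) :
    (bsCount R B ω : ℝ≥0∞) = pointSum (B.indicator 1) R ω := by
  classical
  rw [bsCount, ← ENNReal.tsum_set_one, pointSum, tsum_subtype _ fun _ => (1 : ℝ≥0∞)]
  refine tsum_congr fun i => ?_
  rw [atPoint_indicator, indicator_apply]
  rfl

lemma measurableEmbedding_coe_enat : MeasurableEmbedding ((↑) : ℕ∞ → ℝ≥0∞) where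
  injective := ENat.toENNReal_strictMono.injective
  measurable := Measurable.of_discrete
  measurableSet_image' := fun s _ => (s.to_countable.image _).measurableSet

lemma measurable_bsCount [MeasurableSpace Ω] {R : ℕ → Ω → ℝ≥0∞} (hR : ∀ i, Measurable (R i))
    {B : Set ℝ} (hB : MeasurableSet B) : Measurable (bsCount R B) := by
  rw [← measurableEmbedding_coe_enat.measurable_comp_iff]
  have : ((↑) : ℕ∞ → ℝ≥0∞) ∘ bsCount R B = pointSum (B.indicator 1) R :=
    funext fun ω => coe_bsCount R B ω
  rw [this]
  exact measurable_pointSum (measurable_one.indicator hB) hR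

lemma pointSum_sum_indicator {ι : Type*} [Fintype ι] (B : ι → Set ℝ) (c : ι → ℝ≥0∞)
    (R : ℕ → Ω → ℝ≥0∞) (ω : Ω) :
    pointSum (fun r => ∑ j, (B j).indicator (fun _ => c j) r) R ω
      = ∑ j, c j * bsCount R (B j) ω := by
  simp_rw [coe_bsCount, pointSum, ← ENNReal.tsum_mul_left]
  rw [← Summable.tsum_finsetSum fun _ _ => ENNReal.summable]
  refine tsum_congr fun i => ?_
  by_cases h : R i ω = ∞
  · simp [h]
  · simp only [atPoint, h, if_false]
    refine Finset.sum_congr rfl fun j _ => ?_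
    by_cases hr : (R i ω).toReal ∈ B j <;> simp [hr]

/-- At each point at most one indicator is nonzero, so `φ` is evaluated at a single `c j` or at `0`.
-/
lemma map_sum_indicator_of_disjoint {α ι : Type*} [Fintype ι] {B : ι → Set α}
    (hB : Pairwise (Disjoint on B)) (c : ι → ℝ≥0∞) (φ : ℝ≥0∞ → ℝ≥0∞) (hφ : φ 0 = 0) (r : α) :
    φ (∑ j, (B j).indicator (fun _ => c j) r) = ∑ j, (B j).indicator (fun _ => φ (c j)) r := by
  by_cases h : ∃ j, r ∈ B j
  · obtain ⟨j, hj⟩ := h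
    have hn : ∀ k, k ≠ j → r ∉ B k := fun k hk hr => disjoint_left.1 (hB hk) hr hj
    rw [Finset.sum_eq_single j (fun k _ hk => indicator_of_notMem (hn k hk) _) (by simp),
      Finset.sum_eq_single j (fun k _ hk => indicator_of_notMem (hn k hk) _) (by simp),
      indicator_of_mem hj, indicator_of_mem hj]
  · push Not at h
    rw [Finset.sum_eq_zero fun j _ => indicator_of_notMem (h j) _,
      Finset.sum_eq_zero fun j _ => indicator_of_notMem (h j) _, hφ]

lemma lintegral_one_sub_expNeg_sum_indicator {α ι : Type*} [MeasurableSpace α] [Fintype ι]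
    {B : ι → Set α} (hB : Pairwise (Disjoint on B)) (hBm : ∀ j, MeasurableSet (B j))
    (c : ι → ℝ≥0∞) (μ : Measure α) :
    ∫⁻ r, 1 - expNeg (∑ j, (B j).indicator (fun _ => c j) r) ∂μ
      = ∑ j, μ (B j) * (1 - expNeg (c j)) := by
  simp_rw [map_sum_indicator_of_disjoint hB c (fun x => 1 - expNeg x) (by simp)]
  rw [lintegral_finsetSum _ fun j _ => measurable_const.indicator (hBm j)]
  refine Finset.sum_congr rfl fun j _ => ?_
  rw [lintegral_indicator_const (hBm j), mul_comm]

variable [MeasurableSpace Ω]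

/-! ### The Laplace functional of a Poisson process -/

/-- The Laplace functional of the process listed by `R` is that of a Poisson process with intensity
function `lam`. -/
def HasPoissonLaplace (P : Measure Ω) (lam : ℝ → ℝ) (R : ℕ → Ω → ℝ≥0∞) : Prop :=
  ∀ f : ℝ → ℝ≥0∞, Measurable f →
    ∫⁻ ω, expNeg (pointSum f R ω) ∂P = expNeg (∫⁻ r, 1 - expNeg (f r) ∂meanMeasure lam)

instance (lam : ℝ → ℝ) : SigmaFinite (meanMeasure lam) :=
  SigmaFinite.withDensity_ofReal lam

namespace IsPoissonProcess

variable {P : Measure Ω} [IsProbabilityMeasure P] {lam : ℝ → ℝ} {R : ℕ → Ω → ℝ≥0∞}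

/-- `count_law` speaks of finite values only. The Poisson masses there already add up to one, so the
value `∞` is null. -/
lemma map_bsCount (h : IsPoissonProcess P lam R) {B : Set ℝ} (hB : MeasurableSet B)
    (hfin : meanMeasure lam B ≠ ∞) :
    P.map (bsCount R B) = (poissonMeasure (meanMeasure lam B).toNNReal).map ((↑) : ℕ → ℕ∞) := by
  have hm := measurable_bsCount h.measurable hB
  have he : MeasurableEmbedding ((↑) : ℕ → ℕ∞) :=
    ⟨Nat.cast_injective, .of_discrete, fun _ _ => .of_discrete⟩
  have : IsProbabilityMeasure (P.map (bsCount R B)) :=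
    Measure.isProbabilityMeasure_map hm.aemeasurable
  have : IsProbabilityMeasure
      ((poissonMeasure (meanMeasure lam B).toNNReal).map ((↑) : ℕ → ℕ∞)) :=
    Measure.isProbabilityMeasure_map (Measurable.of_discrete).aemeasurable
  have hpo : poissonMeasure (meanMeasure lam B).toNNReal
      = (P.map (bsCount R B)).comap ((↑) : ℕ → ℕ∞) := by
    refine Measure.ext_of_singleton fun n => ?_
    rw [he.comap_apply, Measure.map_apply hm .of_discrete, ← h.count_law B hB hfin n]
    congr 1
    ext ω
    simp
  refine (Measure.eq_of_le_of_measure_univ_eq ?_ (by simp)).symm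
  rw [hpo, he.map_comap]
  exact Measure.restrict_le_self

lemma lintegral_expNeg_mul_bsCount (h : IsPoissonProcess P lam R) {B : Set ℝ}
    (hB : MeasurableSet B) (hfin : meanMeasure lam B ≠ ∞) (c : ℝ≥0∞) :
    ∫⁻ ω, expNeg (c * bsCount R B ω) ∂P = expNeg (meanMeasure lam B * (1 - expNeg c)) := by
  have hm := measurable_bsCount h.measurable hB
  rw [← lintegral_map (f := fun k : ℕ∞ => expNeg (c * k)) .of_discrete hm, h.map_bsCount hB hfin,
    lintegral_map .of_discrete .of_discrete]
  simp only [ENat.toENNReal_coe, mul_comm c, expNeg_natCast_mul]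
  rw [lintegral_expNeg_poissonMeasure, ENNReal.coe_toNNReal hfin]

omit [IsProbabilityMeasure P] in
lemma iIndepFun_bsCount (h : IsPoissonProcess P lam R) {ι : Type*} [Fintype ι] {B : ι → Set ℝ}
    (hB : Pairwise (Disjoint on B)) (hBm : ∀ j, MeasurableSet (B j))
    (hfin : ∀ j, meanMeasure lam (B j) ≠ ∞) : iIndepFun (fun j => bsCount R (B j)) P := by
  have e := Fintype.equivFin ι
  have := (h.count_indep _ (fun k => B (e.symm k)) (fun k => hBm _) (fun k => hfin _)
    fun i j hij => hB (e.symm.injective.ne hij)).precomp e.injective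
  simpa using this

lemma lintegral_expNeg_pointSum_sum_indicator (h : IsPoissonProcess P lam R) {ι : Type*}
    [Fintype ι] {B : ι → Set ℝ} (hB : Pairwise (Disjoint on B)) (hBm : ∀ j, MeasurableSet (B j))
    (hfin : ∀ j, meanMeasure lam (B j) ≠ ∞) (c : ι → ℝ≥0∞) :
    ∫⁻ ω, expNeg (pointSum (fun r => ∑ j, (B j).indicator (fun _ => c j) r) R ω) ∂P
      = expNeg (∫⁻ r, 1 - expNeg (∑ j, (B j).indicator (fun _ => c j) r) ∂meanMeasure lam) := by
  rw [lintegral_one_sub_expNeg_sum_indicator hB hBm]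
  simp_rw [pointSum_sum_indicator, expNeg_sum]
  rw [lintegral_prod_eq_prod_lintegral_of_indepFun]
  · exact Finset.prod_congr rfl fun j _ => h.lintegral_expNeg_mul_bsCount (hBm j) (hfin j) _
  · exact (h.iIndepFun_bsCount hB hBm hfin).comp (fun j (k : ℕ∞) => expNeg (c j * k))
      fun _ => .of_discrete
  · exact fun j => (Measurable.of_discrete (f := fun k : ℕ∞ => expNeg (c j * k))).comp
      (measurable_bsCount h.measurable (hBm j))

/-- A Poisson process has the Laplace functional `exp (-∫ (1 - exp (-f)))`. -/
lemma hasPoissonLaplace (h : IsPoissonProcess P lam R) : HasPoissonLaplace P lam R := by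
  intro f hf
  set S := spanningSets (meanMeasure lam)
  have hS : ∀ n, MeasurableSet (S n) := measurableSet_spanningSets _
  -- Count laws are assumed only on sets of finite mean measure, hence simple functions cut off to
  -- the spanning sets.
  let g : ℕ → ℝ → ℝ≥0∞ := fun n => (S n).indicator (SimpleFunc.eapprox f n)
  have hgm : ∀ n, Measurable (g n) := fun n => (SimpleFunc.measurable _).indicator (hS n)
  have hmono : ∀ r, Monotone fun n => g n r := fun r m n hmn => by
    refine indicator_le_indicator_of_subset (monotone_spanningSets _ hmn) (fun _ => zero_le) r
      |>.trans ?_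
    exact indicator_le_indicator (SimpleFunc.monotone_eapprox f hmn r)
  have hlim : ∀ r, Filter.Tendsto (fun n => g n r) Filter.atTop (nhds (f r)) := fun r => by
    have h1 : Filter.Tendsto (fun n => SimpleFunc.eapprox f n r) Filter.atTop (nhds (f r)) := by
      rw [← SimpleFunc.iSup_eapprox_apply hf r]
      exact tendsto_atTop_iSup fun m n hmn => SimpleFunc.monotone_eapprox f hmn r
    refine h1.congr' ?_
    filter_upwards [eventually_mem_spanningSets (meanMeasure lam) r] with n hn
    exact (indicator_of_mem hn _).symm
  have hstep : ∀ n, ∫⁻ ω, expNeg (pointSum (g n) R ω) ∂P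
      = expNeg (∫⁻ r, 1 - expNeg (g n r) ∂meanMeasure lam) := fun n => by
    let φ := SimpleFunc.eapprox f n
    have hg : g n = fun r => ∑ y : φ.range, (φ ⁻¹' {y.1} ∩ S n).indicator (fun _ => y.1) r := by
      ext r
      rw [Finset.sum_eq_single ⟨φ r, φ.mem_range_self r⟩]
      · by_cases hr : r ∈ S n <;> simp [g, φ, hr]
      · intro y _ hy
        exact indicator_of_notMem (fun hr => hy (Subtype.ext hr.1.symm)) _
      · simp
    rw [hg]
    refine h.lintegral_expNeg_pointSum_sum_indicator (B := fun y : φ.range => φ ⁻¹' {y.1} ∩ S n)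
      (fun x y hxy => ?_)
      (fun y => (φ.measurableSet_preimage _).inter (hS n)) (fun y => ?_) fun y : φ.range => y.1
    · exact disjoint_left.2 fun r hx hy => hxy (Subtype.ext (hx.1.symm.trans hy.1))
    · exact ((measure_mono inter_subset_right).trans_lt (measure_spanningSets_lt_top _ n)).ne
  have hL : Filter.Tendsto (fun n => ∫⁻ ω, expNeg (pointSum (g n) R ω) ∂P) Filter.atTop
      (nhds (∫⁻ ω, expNeg (pointSum f R ω) ∂P)) := by
    refine tendsto_lintegral_of_dominated_convergence (fun _ => 1)
      (fun n => measurable_expNeg.comp (measurable_pointSum (hgm n) h.measurable))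
      (fun n => ae_of_all _ fun _ => expNeg_le_one _) (by simp) (ae_of_all _ fun ω => ?_)
    refine (continuous_expNeg.tendsto _).comp ?_
    -- The sum over points is an integral against counting measure, so monotone convergence applies
    -- to it as well.
    have := lintegral_tendsto_of_tendsto_of_monotone (μ := Measure.count)
      (f := fun n i => atPoint (g n) (R i ω)) (F := fun i => atPoint f (R i ω))
      (fun n => (Measurable.of_discrete).aemeasurable)
      (ae_of_all _ fun i m n hmn => ?_) (ae_of_all _ fun i => ?_)
    · simpa only [lintegral_count, pointSum] using this
    · simp only [atPoint]
      split_ifs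
      · exact le_rfl
      · exact hmono _ hmn
    · simp only [atPoint]
      split_ifs
      · exact tendsto_const_nhds
      · exact hlim _
  have hRt : Filter.Tendsto (fun n => expNeg (∫⁻ r, 1 - expNeg (g n r) ∂meanMeasure lam))
      Filter.atTop (nhds (expNeg (∫⁻ r, 1 - expNeg (f r) ∂meanMeasure lam))) := by
    refine (continuous_expNeg.tendsto _).comp ?_
    refine lintegral_tendsto_of_tendsto_of_monotone
      (fun n => (measurable_const.sub (measurable_expNeg.comp (hgm n))).aemeasurable)
      (ae_of_all _ fun r m n hmn =>
        tsub_le_tsub_left (expNeg_strictAnti.antitone (hmono r hmn)) _)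
      (ae_of_all _ fun r => ENNReal.Tendsto.sub tendsto_const_nhds
        ((continuous_expNeg.tendsto _).comp (hlim r)) (Or.inl ENNReal.one_ne_top))
  exact tendsto_nhds_unique hL (hRt.congr fun n => (hstep n).symm)

end IsPoissonProcess

/-! ### Recovering the Poisson process from its Laplace functional -/

namespace HasPoissonLaplace

variable {P : Measure Ω} [IsProbabilityMeasure P] {lam : ℝ → ℝ} {R : ℕ → Ω → ℝ≥0∞}

omit [IsProbabilityMeasure P] in
lemma lintegral_expNeg_mul_bsCount (h : HasPoissonLaplace P lam R) {B : Set ℝ}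
    (hB : MeasurableSet B) (c : ℝ≥0∞) :
    ∫⁻ ω, expNeg (c * bsCount R B ω) ∂P = expNeg (meanMeasure lam B * (1 - expNeg c)) := by
  have hd : Pairwise (Disjoint on fun _ : Unit => B) := fun i j hij => (hij rfl).elim
  have h1 := h (fun r => ∑ _j : Unit, B.indicator (fun _ => c) r)
    (by simpa using measurable_const.indicator hB)
  rw [lintegral_one_sub_expNeg_sum_indicator hd (fun _ => hB) fun _ => c] at h1
  simp_rw [pointSum_sum_indicator (fun _ : Unit => B) fun _ => c] at h1
  simpa using h1

omit [IsProbabilityMeasure P] in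
lemma lintegral_prod_expNeg_bsCount (h : HasPoissonLaplace P lam R) {ι : Type*} [Fintype ι]
    {B : ι → Set ℝ} (hB : Pairwise (Disjoint on B)) (hBm : ∀ j, MeasurableSet (B j))
    (c : ι → ℝ≥0∞) :
    ∫⁻ ω, ∏ j, expNeg (c j * bsCount R (B j) ω) ∂P
      = ∏ j, ∫⁻ ω, expNeg (c j * bsCount R (B j) ω) ∂P := by
  have h1 := h (fun r => ∑ j, (B j).indicator (fun _ => c j) r)
    (Finset.measurable_fun_sum _ fun j _ => measurable_const.indicator (hBm j))
  rw [lintegral_one_sub_expNeg_sum_indicator hB hBm] at h1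
  simp_rw [pointSum_sum_indicator, expNeg_sum] at h1
  rw [h1]
  exact Finset.prod_congr rfl fun j _ => (h.lintegral_expNeg_mul_bsCount (hBm j) _).symm

/-- A process with the Laplace functional of a Poisson process is a Poisson process. -/
lemma isPoisson (h : HasPoissonLaplace P lam R) (hR : ∀ i, Measurable (R i)) :
    IsPoissonProcess P lam R := by
  have hm : ∀ {B : Set ℝ}, MeasurableSet B →
      Measurable fun ω => expNegUnit (bsCount R B ω) := fun hB =>
    (Measurable.of_discrete (f := fun k : ℕ∞ => expNegUnit k)).comp (measurable_bsCount hR hB)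
  refine ⟨hR, fun B hB hfin n => ?_, fun m B hBm hfin hB => ?_⟩
  · have hmn : Measurable fun n : ℕ => expNegUnit n := .of_discrete
    have hlaw : P.map (fun ω => expNegUnit (bsCount R B ω))
        = (poissonMeasure (meanMeasure lam B).toNNReal).map (fun n : ℕ => expNegUnit n) := by
      have := Measure.isProbabilityMeasure_map (μ := P) (hm hB).aemeasurable
      have := Measure.isProbabilityMeasure_map
        (μ := poissonMeasure (meanMeasure lam B).toNNReal) hmn.aemeasurable
      -- The moment of order `s` of `exp (-N)` is the Laplace transform of the count `N` at `s`.
      refine ext_of_lintegral_pow fun s => ?_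
      rw [lintegral_map (by fun_prop) (hm hB), lintegral_map (by fun_prop) hmn]
      simp_rw [ofReal_expNegUnit, ← expNeg_natCast_mul]
      rw [h.lintegral_expNeg_mul_bsCount hB]
      simp_rw [mul_comm (s : ℝ≥0∞), expNeg_natCast_mul]
      rw [lintegral_expNeg_poissonMeasure, ENNReal.coe_toNNReal hfin]
    have h2 := congrArg (fun ρ => ρ {expNegUnit n}) hlaw
    rw [Measure.map_apply (hm hB) (measurableSet_singleton _),
      Measure.map_apply hmn (measurableSet_singleton _)] at h2
    convert h2 using 2
    · ext ω
      simp only [mem_ofPred_eq, mem_preimage, mem_singleton_iff, expNegUnit_injective.eq_iff]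
      rw [← ENat.toENNReal_coe, ENat.toENNReal_inj]
    · ext k
      simp [expNegUnit_injective.eq_iff]
  -- Independence is a product formula for the joint law. It holds because mixed moments factor: the
  -- exponent of the Laplace functional is additive over disjoint sets.
  · have hX : iIndepFun (fun j ω => expNegUnit (bsCount R (B j) ω)) P := by
      rw [iIndepFun_iff_map_fun_eq_pi_map fun j => (hm (hBm j)).aemeasurable]
      have := fun j => Measure.isProbabilityMeasure_map (μ := P) (hm (hBm j)).aemeasurable
      have hv : Measurable fun ω j => expNegUnit (bsCount R (B j) ω) :=
        measurable_pi_lambda _ fun j => hm (hBm j)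
      refine ext_of_lintegral_prod_pow fun s => ?_
      rw [lintegral_map (by fun_prop) hv, lintegral_prod_eq_prod_lintegral_of_indepFun _ _
        (iIndepFun_pi (X := fun j (x : unitInterval) => ENNReal.ofReal x ^ s j)
          fun j => by fun_prop) fun j => by fun_prop]
      simp_rw [ofReal_expNegUnit, ← expNeg_natCast_mul]
      rw [h.lintegral_prod_expNeg_bsCount hB hBm]
      refine Finset.prod_congr rfl fun j _ => ?_
      rw [← lintegral_map (f := fun x : unitInterval => ENNReal.ofReal x ^ s j) (by fun_prop)
        (measurable_pi_apply j), (measurePreserving_eval _ j).map_eq,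
        lintegral_map (by fun_prop) (hm (hBm j))]
      simp_rw [ofReal_expNegUnit, ← expNeg_natCast_mul]
    have he : MeasurableEmbedding fun k : ℕ∞ => expNegUnit k :=
      ⟨fun a b e => ENat.toENNReal_inj.1 (expNegUnit_injective e), .of_discrete,
        fun s _ => (s.to_countable.image _).measurableSet⟩
    -- `ψ` is a measurable left inverse of `k ↦ exp (-k)` and carries independence back to the
    -- counts.
    obtain ⟨ψ, hψm, hψ⟩ := he.exists_measurable_extend measurable_id fun _ => ⟨0⟩
    have hψ' : ∀ k : ℕ∞, ψ (expNegUnit k) = k := congrFun hψ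
    simpa [Function.comp_def, hψ'] using hX.comp (fun _ => ψ) fun _ => hψm

end HasPoissonLaplace

end

section

variable {Ω : Type*} [MeasurableSpace Ω] {P : Measure Ω} [IsProbabilityMeasure P]

/-! ### Independent marks -/

/-- Independence factors the finite products. Through `negLog` the infinite product becomes `expNeg`
of a series in `[0, ∞]`, which also covers a vanishing limit. -/
lemma lintegral_expNeg_tsum_of_iIndepFun {X : ℕ → Ω → ℝ≥0∞} (hX : iIndepFun X P)
    (hm : ∀ i, Measurable (X i)) :
    ∫⁻ ω, expNeg (∑' i, X i ω) ∂P = expNeg (∑' i, negLog (∫⁻ ω, expNeg (X i ω) ∂P)) := by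
  have hle : ∀ i, ∫⁻ ω, expNeg (X i ω) ∂P ≤ 1 := fun i =>
    (lintegral_mono fun ω => expNeg_le_one _).trans (by simp)
  have h1 : Filter.Tendsto (fun n => ∫⁻ ω, ∏ i ∈ Finset.range n, expNeg (X i ω) ∂P) Filter.atTop
      (nhds (∫⁻ ω, expNeg (∑' i, X i ω) ∂P)) :=
    tendsto_lintegral_of_dominated_convergence (fun _ => 1)
      (fun n => Finset.measurable_fun_prod _ fun i _ => measurable_expNeg.comp (hm i))
      (fun n => ae_of_all _ fun ω => Finset.prod_le_one' fun i _ => expNeg_le_one _) (by simp)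
      (ae_of_all _ fun ω => tendsto_prod_expNeg _)
  refine tendsto_nhds_unique h1 ((tendsto_prod_expNeg _).congr fun n => ?_)
  rw [lintegral_prod_eq_prod_lintegral_of_indepFun _ (fun i ω => expNeg (X i ω))
    (hX.comp (fun _ => expNeg) fun _ => measurable_expNeg) fun i => measurable_expNeg.comp (hm i)]
  exact Finset.prod_congr rfl fun i _ => expNeg_negLog (hle i)

/-- The Laplace functional of an independently marked Poisson process. -/
lemma HasPoissonLaplace.lintegral_expNeg_tsum_marked {lam : ℝ → ℝ} {R : ℕ → Ω → ℝ≥0∞}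
    (hP : HasPoissonLaplace P lam R) (hR : ∀ i, Measurable (R i)) {β : Type*} [MeasurableSpace β]
    {M : ℕ → Ω → β} (hM : ∀ i, Measurable (M i)) (hind : iIndepFun M P)
    (hid : ∀ i, IdentDistrib (M i) (M 0) P P)
    (hRM : IndepFun (fun ω i => R i ω) (fun ω i => M i ω) P)
    {h : ℝ≥0∞ → β → ℝ≥0∞} (hm : Measurable (uncurry h)) (htop : ∀ b, h ∞ b = 0) :
    ∫⁻ ω, expNeg (∑' i, h (R i ω) (M i ω)) ∂P
      = expNeg (∫⁻ r, ∫⁻ ω, 1 - expNeg (h (ENNReal.ofReal r) (M 0 ω)) ∂P ∂meanMeasure lam) := by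
  -- The factor contributed by a point at `x` once its mark is averaged out; `negLog ∘ G` becomes a
  -- test function for the unmarked process.
  let G : ℝ≥0∞ → ℝ≥0∞ := fun x => ∫⁻ ω, expNeg (h x (M 0 ω)) ∂P
  have hG1 : ∀ x, G x ≤ 1 := fun x => (lintegral_mono fun ω => expNeg_le_one _).trans (by simp)
  have hGm : Measurable G := by
    refine Measurable.lintegral_prod_right' (f := fun p : ℝ≥0∞ × Ω => expNeg (h p.1 (M 0 p.2))) ?_
    exact measurable_expNeg.comp
      (hm.comp (measurable_fst.prodMk ((hM 0).comp measurable_snd)))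
  have hhm : ∀ x, Measurable (h x) := fun x => hm.comp measurable_prodMk_left
  have hmarks : ∀ ρ : ℕ → ℝ≥0∞, ∫⁻ ω, expNeg (∑' i, h (ρ i) (M i ω)) ∂P
      = expNeg (∑' i, negLog (G (ρ i))) := fun ρ => by
    rw [lintegral_expNeg_tsum_of_iIndepFun (X := fun i ω => h (ρ i) (M i ω))
      (hind.comp (fun i => h (ρ i)) fun i => hhm _) fun i => (hhm _).comp (hM i)]
    congr 2 with i
    congr 1
    exact ((hid i).comp (measurable_expNeg.comp (hhm (ρ i)))).lintegral_eq
  have hRm : Measurable fun ω i => R i ω := measurable_pi_lambda _ hR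
  have hMm : Measurable fun ω i => M i ω := measurable_pi_lambda _ hM
  have hcoord : ∀ i, Measurable fun p : (ℕ → ℝ≥0∞) × (ℕ → β) => (p.1 i, p.2 i) := fun i =>
    ((measurable_pi_apply i).comp measurable_fst).prodMk
      ((measurable_pi_apply i).comp measurable_snd)
  let H : (ℕ → ℝ≥0∞) × (ℕ → β) → ℝ≥0∞ := fun p => expNeg (∑' i, h (p.1 i) (p.2 i))
  have hH : Measurable H := measurable_expNeg.comp <| Measurable.tsum fun i =>
    hm.comp (hcoord i)
  have := Measure.isProbabilityMeasure_map (μ := P) hMm.aemeasurable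
  have hlaw := (indepFun_iff_map_prod_eq_prod_map_map hRm.aemeasurable hMm.aemeasurable).1 hRM
  -- Distances and marks have a product joint law, so the marks are integrated out with the
  -- distances frozen.
  have e1 : ∫⁻ ω, expNeg (∑' i, h (R i ω) (M i ω)) ∂P
      = ∫⁻ ω, expNeg (∑' i, negLog (G (R i ω))) ∂P := by
    calc _ = ∫⁻ p, H p ∂(P.map fun ω => (fun i => R i ω, fun i => M i ω)) :=
          (lintegral_map hH (hRm.prodMk hMm)).symm
      _ = ∫⁻ ω, ∫⁻ ω', H (fun i => R i ω, fun i => M i ω') ∂P ∂P := by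
          rw [hlaw, lintegral_prod _ hH.aemeasurable, lintegral_map hH.lintegral_prod_right' hRm]
          exact lintegral_congr fun ω => lintegral_map (hH.comp measurable_prodMk_left) hMm
      _ = _ := lintegral_congr fun ω => hmarks _
  have hG_top : negLog (G ∞) = 0 := by
    have := negLog_expNeg 0
    simp_all [G]
  have e2 : ∀ ω, ∑' i, negLog (G (R i ω))
      = pointSum (fun r => negLog (G (ENNReal.ofReal r))) R ω := fun ω => tsum_congr fun i => by
    by_cases hi : R i ω = ∞
    · rw [hi, atPoint_top, hG_top]
    · rw [atPoint, if_neg hi, ENNReal.ofReal_toReal hi]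
  simp_rw [e1, e2]
  rw [hP (fun r => negLog (G (ENNReal.ofReal r)))
    (measurable_negLog.comp (hGm.comp ENNReal.measurable_ofReal))]
  congr 1
  refine lintegral_congr fun r => ?_
  rw [expNeg_negLog (hG1 _), lintegral_sub' (by
    exact (measurable_expNeg.comp ((hhm _).comp (hM 0))).aemeasurable)
    (ne_top_of_le_ne_top ENNReal.one_ne_top (hG1 _)) (ae_of_all _ fun ω => expNeg_le_one _)]
  simp [G]

/-! ### Scaling the distances -/

lemma lintegral_meanMeasure {lam : ℝ → ℝ} (hlam : Measurable lam) {g : ℝ → ℝ≥0∞}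
    (hg : Measurable g) :
    ∫⁻ r, g r ∂meanMeasure lam = ∫⁻ r in Ici 0, g r * ENNReal.ofReal (lam r) := by
  rw [meanMeasure, lintegral_withDensity_eq_lintegral_mul _ hlam.ennreal_ofReal hg]
  simp [mul_comm]

lemma meanMeasure_absolutelyContinuous (lam : ℝ → ℝ) : meanMeasure lam ≪ volume :=
  (withDensity_absolutelyContinuous _ _).trans Measure.absolutelyContinuous_restrict

/-- For `w > 0` this is the substitution `r = u * w ^ (1 / ε)`, whose Jacobian is the factor in
front of `lam`. For `w = 0` both sides vanish. -/
lemma lintegral_meanMeasure_scaled {ε : ℝ} (hε : 0 < ε) {lam : ℝ → ℝ} (hlam : Measurable lam)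
    {f : ℝ → ℝ≥0∞} (hf : Measurable f) {w : ℝ} (hw : 0 ≤ w) :
    ∫⁻ r, 1 - expNeg (atPoint f (ENNReal.ofReal r * ENNReal.ofReal w ^ (-(1 / ε))))
        ∂meanMeasure lam
      = ∫⁻ r in Ici 0,
        (1 - expNeg (f r)) * ENNReal.ofReal (w ^ (1 / ε) * lam (r * w ^ (1 / ε))) := by
  rcases hw.eq_or_lt with rfl | hw
  · have h0 : (0 : ℝ) ^ (1 / ε) = 0 := Real.zero_rpow (by positivity)
    have h1 : (0 : ℝ≥0∞) ^ (-(1 / ε)) = ∞ := ENNReal.zero_rpow_of_neg (by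
      rw [neg_lt_zero]; positivity)
    rw [h0, ENNReal.ofReal_zero, h1]
    simp only [zero_mul, ENNReal.ofReal_zero, mul_zero, lintegral_zero]
    -- A zero mark sends positive distances to `∞`, discarding the BS. Distance `0` must be excluded
    -- as a null set because `0 * ∞ = 0`.
    have hae : ∀ᵐ r ∂meanMeasure lam, 0 < r := by
      have h2 : ∀ᵐ r : ℝ ∂volume.restrict (Ici 0), 0 < r := by
        rw [← restrict_Ioi_eq_restrict_Ici]
        exact ae_restrict_mem measurableSet_Ioi
      exact (withDensity_absolutelyContinuous _ _).ae_le h2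
    refine lintegral_eq_zero_of_ae_eq_zero ?_
    filter_upwards [hae] with r hr
    rw [ENNReal.mul_top (by simpa using hr)]
    simp
  · set c := w ^ (1 / ε)
    have hc : 0 < c := Real.rpow_pos_of_pos hw _
    have hcw : ENNReal.ofReal w ^ (-(1 / ε)) = ENNReal.ofReal c⁻¹ := by
      rw [ENNReal.rpow_neg, ENNReal.ofReal_rpow_of_pos hw, ENNReal.ofReal_inv_of_pos hc]
    have hkm : Measurable fun r : ℝ =>
        1 - expNeg (atPoint f (ENNReal.ofReal r * ENNReal.ofReal c⁻¹)) :=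
      measurable_const.sub (measurable_expNeg.comp
        ((measurable_atPoint hf).comp (ENNReal.measurable_ofReal.mul_const _)))
    rw [hcw, lintegral_meanMeasure hlam hkm,
      ← lintegral_indicator measurableSet_Ici, ← lintegral_indicator measurableSet_Ici]
    set G : ℝ → ℝ≥0∞ := (Ici 0).indicator fun r =>
      (1 - expNeg (atPoint f (ENNReal.ofReal r * ENNReal.ofReal c⁻¹))) * ENNReal.ofReal (lam r)
    have hG : Measurable G := (hkm.mul
      hlam.ennreal_ofReal).indicator measurableSet_Ici
    rw [← Real.smul_map_volume_mul_left hc.ne', lintegral_smul_measure,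
      lintegral_map hG (measurable_const_mul c), Real.smul_map_volume_mul_left hc.ne',
      smul_eq_mul, ← lintegral_const_mul' _ _ ENNReal.ofReal_ne_top, abs_of_pos hc]
    refine lintegral_congr fun u => ?_
    by_cases hu : 0 ≤ u
    · have hcu : c * u ∈ Ici (0 : ℝ) := mul_nonneg hc.le hu
      simp only [G]
      rw [indicator_of_mem hcu, indicator_of_mem (mem_Ici.2 hu),
        ← ENNReal.ofReal_mul (mul_nonneg hc.le hu), atPoint, if_neg ENNReal.ofReal_ne_top,
        ENNReal.toReal_ofReal (by positivity), mul_right_comm, mul_inv_cancel₀ hc.ne', one_mul,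
        ENNReal.ofReal_mul hc.le,
        mul_comm c u]
      ring
    · have hcu : c * u ∉ Ici (0 : ℝ) := by
        simp only [mem_Ici, not_le] at *
        exact mul_neg_of_pos_of_neg hc hu
      simp only [G]
      rw [indicator_of_notMem hcu, indicator_of_notMem (by simpa using hu), mul_zero]

lemma measurable_densityIntegrand (ε : ℝ) {lam : ℝ → ℝ} (hlam : Measurable lam) {Ψ K : Ω → ℝ}
    (hΨ : Measurable Ψ) (hK : Measurable K) :
    Measurable fun p : ℝ × Ω => densityIntegrand ε lam Ψ K p.1 p.2 := by
  have hw : Measurable fun p : ℝ × Ω => (Ψ p.2 * K p.2) ^ (1 / ε) := by fun_prop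
  exact hw.mul (hlam.comp (measurable_fst.mul hw))

omit [IsProbabilityMeasure P] in
-- The Bochner expectation defaults to `0` where it diverges; `hconv` confines this to a null set of
-- `r`, which a density does not see.
lemma meanMeasure_modifiedDensity {ε : ℝ} {lam : ℝ → ℝ} (hlam_nonneg : ∀ r, 0 ≤ r → 0 ≤ lam r)
    {Ψ K : Ω → ℝ} (hΨ0 : ∀ᵐ ω ∂P, 0 ≤ Ψ ω) (hK0 : ∀ᵐ ω ∂P, 0 ≤ K ω)
    (hconv : ∀ᵐ r ∂(volume.restrict (Ici (0 : ℝ))),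
      Integrable (densityIntegrand ε lam Ψ K r) P) :
    meanMeasure (modifiedDensity P ε lam Ψ K) = (volume.restrict (Ici 0)).withDensity
      fun r => ∫⁻ ω, ENNReal.ofReal (densityIntegrand ε lam Ψ K r ω) ∂P := by
  refine withDensity_congr_ae ?_
  filter_upwards [hconv, ae_restrict_mem measurableSet_Ici] with r hr hr0
  refine ofReal_integral_eq_lintegral_ofReal hr ?_
  filter_upwards [hΨ0, hK0] with ω h1 h2
  have hc : 0 ≤ (Ψ ω * K ω) ^ (1 / ε) := Real.rpow_nonneg (mul_nonneg h1 h2) _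
  exact mul_nonneg hc (hlam_nonneg _ (mul_nonneg hr0 hc))

/-- Rescaling the distances of a shotgun cellular system by the fadings and powers turns it into a
Poisson process with the modified density. -/
lemma IsSCS.hasPoissonLaplace_scaled {ε : ℝ} (hε : 0 < ε) {lam : ℝ → ℝ} (hlam : Measurable lam)
    (hlam_nonneg : ∀ r, 0 ≤ r → 0 ≤ lam r) {R : ℕ → Ω → ℝ≥0∞} {Ψ K : ℕ → Ω → ℝ}
    (hS : IsSCS P lam R Ψ K)
    (hconv : ∀ᵐ r ∂(volume.restrict (Ici (0 : ℝ))),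
      Integrable (densityIntegrand ε lam (Ψ 0) (K 0) r) P) :
    HasPoissonLaplace P (modifiedDensity P ε lam (Ψ 0) (K 0))
      (fun i ω => R i ω * ENNReal.ofReal (Ψ i ω * K i ω) ^ (-(1 / ε))) := by
  intro f hf
  have hΨ := hS.measurable_fading
  have hK := hS.measurable_power
  have hscale : Measurable fun p : ℝ≥0∞ × (ℝ × ℝ) =>
      p.1 * ENNReal.ofReal (p.2.1 * p.2.2) ^ (-(1 / ε)) := by fun_prop
  -- The scale factor is never `0`, so an index without BS keeps the distance `∞`.
  have hne : ∀ w : ℝ, ENNReal.ofReal w ^ (-(1 / ε)) ≠ 0 := fun w h => by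
    rcases ENNReal.rpow_eq_zero_iff.1 h with ⟨-, h⟩ | ⟨h, -⟩
    · have : 0 < 1 / ε := by positivity
      linarith
    · exact ENNReal.ofReal_ne_top h
  have h1 := hS.poisson.hasPoissonLaplace.lintegral_expNeg_tsum_marked hS.poisson.measurable
    (M := fun i ω => (Ψ i ω, K i ω)) (fun i => (hΨ i).prodMk (hK i)) hS.indep hS.identDistrib
    hS.indep_distances
    (h := fun x m => atPoint f (x * ENNReal.ofReal (m.1 * m.2) ^ (-(1 / ε))))
    ((measurable_atPoint hf).comp hscale) (fun m => by
      rw [ENNReal.top_mul (hne _), atPoint_top])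
  simp only at h1
  unfold pointSum
  rw [h1]
  congr 1
  have hfm : Measurable fun r => 1 - expNeg (f r) :=
    measurable_const.sub (measurable_expNeg.comp hf)
  have hdm := measurable_densityIntegrand ε hlam (hΨ 0) (hK 0)
  rw [lintegral_lintegral_swap, meanMeasure_modifiedDensity hlam_nonneg (hS.fading_nonneg 0)
    (hS.power_nonneg 0) hconv, lintegral_withDensity_eq_lintegral_mul _
      hdm.ennreal_ofReal.lintegral_prod_right' hfm]
  -- For a fixed mark the substitution moves the mark from `f` into the density; Tonelli then forms
  -- the expectation that defines the modified density.
  · calc _ = ∫⁻ ω, ∫⁻ r in Ici 0, (1 - expNeg (f r)) *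
          ENNReal.ofReal (densityIntegrand ε lam (Ψ 0) (K 0) r ω) ∂volume ∂P := by
          refine lintegral_congr_ae ?_
          filter_upwards [hS.fading_nonneg 0, hS.power_nonneg 0] with ω h2 h3
          exact lintegral_meanMeasure_scaled hε hlam hf (mul_nonneg h2 h3)
      _ = ∫⁻ r in Ici 0, ∫⁻ ω, (1 - expNeg (f r)) *
          ENNReal.ofReal (densityIntegrand ε lam (Ψ 0) (K 0) r ω) ∂P ∂volume :=
          lintegral_lintegral_swap ((hfm.comp measurable_snd).mul
            (hdm.comp measurable_swap).ennreal_ofReal).aemeasurable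
      _ = _ := by
          refine lintegral_congr fun r => ?_
          rw [lintegral_const_mul (f := fun ω => ENNReal.ofReal
            (densityIntegrand ε lam (Ψ 0) (K 0) r ω)) _
            (hdm.comp measurable_prodMk_left).ennreal_ofReal, mul_comm]
          rfl
  · have hp : Measurable fun p : ℝ × Ω => (ENNReal.ofReal p.1, (Ψ 0 p.2, K 0 p.2)) :=
      (ENNReal.measurable_ofReal.comp measurable_fst).prodMk
        (((hΨ 0).comp measurable_snd).prodMk ((hK 0).comp measurable_snd))
    have := (measurable_atPoint hf).comp (hscale.comp hp)
    exact (measurable_const.sub (measurable_expNeg.comp this)).aemeasurable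

end

section

/-! ### The ratio of the largest term to the rest -/

/-- The ratio of the largest term to the rest, as a function of the sum `T` and the supremum `M`. -/
noncomputable def supToRest (T M : ℝ≥0∞) : ℝ≥0∞ := if T = ∞ then 0 else M / (T - M)

lemma measurable_supToRest : Measurable fun p : ℝ≥0∞ × ℝ≥0∞ => supToRest p.1 p.2 :=
  Measurable.ite (measurable_fst (measurableSet_singleton _)) measurable_const
    (measurable_snd.div (measurable_fst.sub measurable_snd))

/-- Only finitely many terms can be at least as large as a given positive one. -/
lemma exists_forall_le_of_tsum_ne_top {p : ℕ → ℝ≥0∞} (hp : ∑' i, p i ≠ ∞) :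
    ∃ s, ∀ i, p i ≤ p s := by
  by_cases h : ∃ j, p j ≠ 0
  · obtain ⟨j, hj⟩ := h
    obtain ⟨s, hs, hmax⟩ := Set.exists_max_image _ p
      (ENNReal.finite_const_le_of_tsum_ne_top hp hj) ⟨j, le_refl (p j)⟩
    refine ⟨s, fun i => ?_⟩
    rcases le_total (p j) (p i) with h | h
    · exact hmax i h
    · exact h.trans hs
  · push Not at h
    exact ⟨0, fun i => by simp [h]⟩

/-- The right side is measurable in the sum and the supremum and involves no choice of index.
Without a maximum the sum is infinite; with a finite maximum and infinite sum the rest is infinite.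
Both cases give `0`. -/
lemma maxToRest_eq {p : ℕ → ℝ≥0∞} (hp : ∀ i, p i ≠ ∞) :
    maxToRest p = supToRest (∑' i, p i) (⨆ i, p i) := by
  classical
  by_cases h : ∃ s, ∀ i, p i ≤ p s
  · have hs := h.choose_spec
    rw [maxToRest, dif_pos h]
    set s := h.choose
    have hsup : ⨆ i, p i = p s := le_antisymm (iSup_le hs) (le_iSup p s)
    have hsum : ∑' i, p i = p s + ∑' i, (if i = s then 0 else p i) := by
      convert! ENNReal.tsum_eq_add_tsum_ite (f := p) s
    rw [hsup, supToRest]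
    split_ifs with hT
    · have : ∑' i, (if i = s then 0 else p i) = ∞ := by
        rw [hT] at hsum
        exact (ENNReal.add_eq_top.1 hsum.symm).resolve_left (hp s)
      simp only [this, ENNReal.div_top]
    · rw [hsum, ENNReal.add_sub_cancel_left (hp s)]
  · rw [maxToRest, dif_neg h, supToRest, if_pos]
    by_contra hT
    exact h (exists_forall_le_of_tsum_ne_top hT)

/-! ### The joint law of the sum and the supremum over a Poisson process -/

variable {Ω Ω' : Type*} [MeasurableSpace Ω] [MeasurableSpace Ω']

/-- The supremum of `f` over the points listed by `R`. -/
noncomputable def pointSup (f : ℝ → ℝ≥0∞) (R : ℕ → Ω → ℝ≥0∞) (ω : Ω) : ℝ≥0∞ :=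
  ⨆ i, atPoint f (R i ω)

lemma measurable_pointSup {f : ℝ → ℝ≥0∞} (hf : Measurable f) {R : ℕ → Ω → ℝ≥0∞}
    (hR : ∀ i, Measurable (R i)) : Measurable (pointSup f R) :=
  Measurable.iSup fun i => (measurable_atPoint hf).comp (hR i)

omit [MeasurableSpace Ω] in
-- Weight `∞` on points with `f > a` annihilates exactly the configurations with supremum above `a`,
-- so one Laplace functional sees both the event `sup ≤ a` and a power of `exp (-sum)`.
lemma expNeg_pointSum_truncated (f : ℝ → ℝ≥0∞) (R : ℕ → Ω → ℝ≥0∞) (n : ℕ) (a : ℝ≥0∞) (ω : Ω) :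
    expNeg (pointSum (fun r => n * f r + (f ⁻¹' Ioi a).indicator (fun _ => ∞) r) R ω)
      = (pointSup f R ⁻¹' Iic a).indicator (fun ω => expNeg (pointSum f R ω) ^ n) ω := by
  have hsum : pointSum (fun r => n * f r + (f ⁻¹' Ioi a).indicator (fun _ => ∞) r) R ω
      = n * pointSum f R ω + pointSum ((f ⁻¹' Ioi a).indicator fun _ => ∞) R ω := by
    rw [pointSum, pointSum, pointSum, ← ENNReal.tsum_mul_left, ← ENNReal.tsum_add]
    refine tsum_congr fun i => ?_
    by_cases hi : R i ω = ∞ <;> simp [atPoint, hi]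
  rw [hsum, expNeg_add, expNeg_natCast_mul]
  by_cases h : pointSup f R ω ≤ a
  · have h0 : pointSum ((f ⁻¹' Ioi a).indicator fun _ => ∞) R ω = 0 := by
      refine ENNReal.tsum_eq_zero.2 fun i => ?_
      by_cases hi : R i ω = ∞
      · simp [hi]
      · have := (le_iSup (fun i => atPoint f (R i ω)) i).trans h
        simp only [atPoint, hi, if_false] at this ⊢
        exact indicator_of_notMem (s := f ⁻¹' Ioi a) (fun hm => (not_lt.2 this) hm) _
    rw [h0, expNeg_zero, mul_one, indicator_of_mem (show ω ∈ (pointSup f R ⁻¹' Iic a) from h)]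
  · rw [indicator_of_notMem (show ω ∉ (pointSup f R ⁻¹' Iic a) from h)]
    rw [not_le, pointSup, lt_iSup_iff] at h
    obtain ⟨i, hi⟩ := h
    have hfin : R i ω ≠ ∞ := fun e => by simp [e] at hi
    simp only [atPoint, hfin, if_false] at hi
    have : pointSum ((f ⁻¹' Ioi a).indicator fun _ => ∞) R ω = ∞ := by
      refine ENNReal.tsum_eq_top_of_eq_top ⟨i, ?_⟩
      simp only [atPoint, hfin, if_false]
      exact indicator_of_mem (s := f ⁻¹' Ioi a) hi _
    rw [this, expNeg_top, mul_zero]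

lemma HasPoissonLaplace.map_pointSum_pointSup_eq {P : Measure Ω} [IsProbabilityMeasure P]
    {P' : Measure Ω'} [IsProbabilityMeasure P'] {lam : ℝ → ℝ} {R : ℕ → Ω → ℝ≥0∞}
    {R' : ℕ → Ω' → ℝ≥0∞} (h : HasPoissonLaplace P lam R) (h' : HasPoissonLaplace P' lam R')
    (hR : ∀ i, Measurable (R i)) (hR' : ∀ i, Measurable (R' i)) {f : ℝ → ℝ≥0∞}
    (hf : Measurable f) :
    P.map (fun ω => (expNegUnit (pointSum f R ω), pointSup f R ω))
      = P'.map (fun ω => (expNegUnit (pointSum f R' ω), pointSup f R' ω)) := by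
  have hU : Measurable fun ω => expNegUnit (pointSum f R ω) :=
    measurable_expNegUnit.comp (measurable_pointSum hf hR)
  have hU' : Measurable fun ω => expNegUnit (pointSum f R' ω) :=
    measurable_expNegUnit.comp (measurable_pointSum hf hR')
  have hM := measurable_pointSup hf hR
  have hM' := measurable_pointSup hf hR'
  -- Moments in `n` determine the law of `exp (-sum)` on the event `sup ≤ a`.
  have key : ∀ a, (P.restrict (pointSup f R ⁻¹' Iic a)).map (fun ω => expNegUnit (pointSum f R ω))
      = (P'.restrict (pointSup f R' ⁻¹' Iic a)).map (fun ω => expNegUnit (pointSum f R' ω)) := by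
    intro a
    refine ext_of_lintegral_pow fun n => ?_
    have hg : Measurable fun r => n * f r + (f ⁻¹' Ioi a).indicator (fun _ => ∞) r :=
      (hf.const_mul _).add (measurable_const.indicator (hf measurableSet_Ioi))
    rw [lintegral_map (by fun_prop) hU, lintegral_map (by fun_prop) hU']
    simp only [ofReal_expNegUnit]
    rw [← lintegral_indicator (hM measurableSet_Iic), ← lintegral_indicator (hM' measurableSet_Iic)]
    calc _ = _ := lintegral_congr fun ω => (expNeg_pointSum_truncated f R n a ω).symm
      _ = _ := (h _ hg).trans (h' _ hg).symm
      _ = _ := lintegral_congr fun ω => expNeg_pointSum_truncated f R' n a ω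
  refine Measure.ext_prod fun {A C} hA hC => ?_
  rw [Measure.map_apply (hU.prodMk hM) (hA.prod hC),
    Measure.map_apply (hU'.prodMk hM') (hA.prod hC)]
  -- The roles are exchanged: with `exp (-sum)` confined to `A`, the half-lines `Iic a` determine
  -- the law of the supremum.
  have hA1 : (P.restrict ((fun ω => expNegUnit (pointSum f R ω)) ⁻¹' A)).map (pointSup f R)
      = (P'.restrict ((fun ω => expNegUnit (pointSum f R' ω)) ⁻¹' A)).map (pointSup f R') := by
    refine Measure.ext_of_Iic _ _ fun a => ?_
    rw [Measure.map_apply hM measurableSet_Iic, Measure.map_apply hM' measurableSet_Iic,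
      Measure.restrict_apply (hM measurableSet_Iic), Measure.restrict_apply (hM' measurableSet_Iic),
      inter_comm, inter_comm (pointSup f R' ⁻¹' _)]
    have := congrArg (fun ρ => ρ A) (key a)
    rwa [Measure.map_apply hU hA, Measure.map_apply hU' hA, Measure.restrict_apply (hU hA),
      Measure.restrict_apply (hU' hA)] at this
  have := congrArg (fun ρ => ρ C) hA1
  rw [Measure.map_apply hM hC, Measure.map_apply hM' hC, Measure.restrict_apply (hM hC),
    Measure.restrict_apply (hM' hC), inter_comm, inter_comm (pointSup f R' ⁻¹' _)] at this
  exact this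

/-! ### The carrier-to-interference ratio -/

section CarrierToInterference

variable {P : Measure Ω} [IsProbabilityMeasure P]

/-- The mean measure has no atoms. Excluding distance `0` keeps the received powers finite, as
`maxToRest_eq` requires. -/
lemma IsPoissonProcess.ae_ne_zero {lam : ℝ → ℝ} {R : ℕ → Ω → ℝ≥0∞}
    (h : IsPoissonProcess P lam R) : ∀ᵐ ω ∂P, ∀ i, R i ω ≠ 0 := by
  have h0 : meanMeasure lam {0} = 0 := meanMeasure_absolutelyContinuous lam (by simp)
  have h1 := h.count_law {0} (measurableSet_singleton _) (by simp [h0]) 0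
  rw [h0, ENNReal.toNNReal_zero, poissonMeasure_singleton] at h1
  have h2 : ∀ᵐ ω ∂P, bsCount R {0} ω = (0 : ℕ) := by
    have hm : MeasurableSet {ω | bsCount R {0} ω = (0 : ℕ)} :=
      measurable_bsCount h.measurable (measurableSet_singleton _)
        (.of_discrete (s := {((0 : ℕ) : ℕ∞)}))
    refine (mem_ae_iff_prob_eq_one hm).2 ?_
    simpa using h1
  filter_upwards [h2] with ω hω i hi
  rw [bsCount, Nat.cast_zero, Set.encard_eq_zero] at hω
  exact (hω.subset (show i ∈ _ from ⟨0, rfl, le_rfl, by simpa using hi⟩)).elim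

/-- The power received from distance `r` in a system with unit fadings and powers. -/
noncomputable def pathGain (ε r : ℝ) : ℝ≥0∞ := ENNReal.ofReal r ^ (-ε)

lemma measurable_pathGain (ε : ℝ) : Measurable (pathGain ε) := by
  unfold pathGain; fun_prop

omit [MeasurableSpace Ω] in
lemma receivedPower_one {ε : ℝ} (hε : 0 < ε) (R : ℕ → Ω → ℝ≥0∞) (i : ℕ) (ω : Ω) :
    receivedPower ε R (fun _ _ => 1) (fun _ _ => 1) i ω = atPoint (pathGain ε) (R i ω) := by
  by_cases h : R i ω = ∞
  · simp [receivedPower, h, hε]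
  · simp [receivedPower, atPoint, pathGain, h]

/-- The sum is written through `expNegUnit` because the joint law with the supremum is known in that
form. -/
lemma IsPoissonProcess.carrierToInterference_ae_eq {ε : ℝ} (hε : 0 < ε) {lam : ℝ → ℝ}
    {R : ℕ → Ω → ℝ≥0∞} (h : IsPoissonProcess P lam R) :
    carrierToInterference ε R (fun _ _ => 1) (fun _ _ => 1) =ᵐ[P]
      fun ω => supToRest (negLog (ENNReal.ofReal (expNegUnit (pointSum (pathGain ε) R ω))))
        (pointSup (pathGain ε) R ω) := by
  filter_upwards [h.ae_ne_zero] with ω hω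
  rw [carrierToInterference, negLog_expNegUnit, maxToRest_eq]
  · simp_rw [receivedPower_one hε]
    rfl
  · intro i
    have : R i ω ^ (-ε) ≠ ∞ := by
      rw [Ne, ENNReal.rpow_eq_top_iff]
      rintro (⟨h0, -⟩ | ⟨-, h0⟩)
      · exact hω i h0
      · linarith
    simpa [receivedPower] using this

/-- Unit systems with the same density have the same law of the carrier-to-interference ratio. -/
lemma IsPoissonProcess.identDistrib_carrierToInterference {P' : Measure Ω'}
    [IsProbabilityMeasure P'] {ε : ℝ} (hε : 0 < ε) {lam : ℝ → ℝ} {R : ℕ → Ω → ℝ≥0∞}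
    {R' : ℕ → Ω' → ℝ≥0∞} (h : IsPoissonProcess P lam R) (h' : IsPoissonProcess P' lam R') :
    IdentDistrib (carrierToInterference ε R (fun _ _ => 1) (fun _ _ => 1))
      (carrierToInterference ε R' (fun _ _ => 1) (fun _ _ => 1)) P P' := by
  have hf := measurable_pathGain ε
  have hpair : IdentDistrib
      (fun ω => (expNegUnit (pointSum (pathGain ε) R ω), pointSup (pathGain ε) R ω))
      (fun ω => (expNegUnit (pointSum (pathGain ε) R' ω), pointSup (pathGain ε) R' ω)) P P' :=
    ⟨((measurable_expNegUnit.comp (measurable_pointSum hf h.measurable)).prodMk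
        (measurable_pointSup hf h.measurable)).aemeasurable,
      ((measurable_expNegUnit.comp (measurable_pointSum hf h'.measurable)).prodMk
        (measurable_pointSup hf h'.measurable)).aemeasurable,
      h.hasPoissonLaplace.map_pointSum_pointSup_eq h'.hasPoissonLaplace h.measurable h'.measurable
        hf⟩
  have hG : Measurable fun p : unitInterval × ℝ≥0∞ =>
      supToRest (negLog (ENNReal.ofReal p.1)) p.2 :=
    measurable_supToRest.comp ((by fun_prop : Measurable fun p : unitInterval × ℝ≥0∞ =>
      negLog (ENNReal.ofReal p.1)).prodMk measurable_snd)
  have hcomp := hpair.comp hG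
  have e := h.carrierToInterference_ae_eq hε
  have e' := h'.carrierToInterference_ae_eq hε
  exact ((IdentDistrib.of_ae_eq hcomp.aemeasurable_fst e.symm).symm.trans hcomp).trans
    (IdentDistrib.of_ae_eq hcomp.aemeasurable_snd e'.symm)

omit [MeasurableSpace Ω] in
-- The exponents cancel. `R i ω ≠ 0` matters when the mark vanishes: the rescaled distance would be
-- `0 * ∞ = 0`, with power `∞` instead of `0`.
lemma receivedPower_scaled {ε : ℝ} (hε : 0 < ε) {R : ℕ → Ω → ℝ≥0∞} {Ψ K : ℕ → Ω → ℝ} {i : ℕ}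
    {ω : Ω} (hR : R i ω ≠ 0) :
    receivedPower ε R Ψ K i ω = receivedPower ε
      (fun i ω => R i ω * ENNReal.ofReal (Ψ i ω * K i ω) ^ (-(1 / ε))) (fun _ _ => 1)
      (fun _ _ => 1) i ω := by
  have he : 0 < 1 / ε := by positivity
  have hRt : R i ω ^ (-ε) ≠ ∞ := by
    rw [Ne, ENNReal.rpow_eq_top_iff]
    rintro (⟨h0, -⟩ | ⟨-, h0⟩)
    · exact hR h0
    · linarith
  simp only [receivedPower, mul_one, ENNReal.ofReal_one, one_mul, mul_comm (K i ω)]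
  set w := ENNReal.ofReal (Ψ i ω * K i ω)
  have hw : w ≠ ∞ := ENNReal.ofReal_ne_top
  have hw0 : w ^ (-(1 / ε)) ≠ 0 := fun h => by
    rcases ENNReal.rpow_eq_zero_iff.1 h with ⟨-, h⟩ | ⟨h, -⟩
    · linarith
    · exact hw h
  rw [ENNReal.mul_rpow_of_ne_zero hR hw0, ← ENNReal.rpow_mul]
  have : -(1 / ε) * -ε = 1 := by field_simp
  rw [this, ENNReal.rpow_one, mul_comm]

end CarrierToInterference

/-! ### The rescaled system as a unit system, and the equivalence -/

/-- The distances rescaled by the fadings and powers form a Poisson process with the modified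
density. -/
lemma IsSCS.isPoisson_scaled {P : Measure Ω} [IsProbabilityMeasure P] {ε : ℝ} (hε : 0 < ε)
    {lam : ℝ → ℝ} (hlam : Measurable lam) (hlam_nonneg : ∀ r, 0 ≤ r → 0 ≤ lam r)
    {R : ℕ → Ω → ℝ≥0∞} {Ψ K : ℕ → Ω → ℝ} (hS : IsSCS P lam R Ψ K)
    (hconv : ∀ᵐ r ∂(volume.restrict (Ici (0 : ℝ))),
      Integrable (densityIntegrand ε lam (Ψ 0) (K 0) r) P) :
    IsPoissonProcess P (modifiedDensity P ε lam (Ψ 0) (K 0))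
      (fun i ω => R i ω * ENNReal.ofReal (Ψ i ω * K i ω) ^ (-(1 / ε))) := by
  refine (hS.hasPoissonLaplace_scaled hε hlam hlam_nonneg hconv).isPoisson fun i => ?_
  have := hS.poisson.measurable i
  have := hS.measurable_fading i
  have := hS.measurable_power i
  fun_prop

/-- A Poisson process of distances is a shotgun cellular system with unit fadings and powers. -/
lemma IsPoissonProcess.isSCS_one {P : Measure Ω} [IsProbabilityMeasure P] {lam : ℝ → ℝ}
    {R : ℕ → Ω → ℝ≥0∞} (h : IsPoissonProcess P lam R) :
    IsSCS P lam R (fun _ _ => 1) (fun _ _ => 1) where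
  poisson := h
  measurable_fading _ := measurable_const
  measurable_power _ := measurable_const
  fading_nonneg _ := ae_of_all _ fun _ => zero_le_one
  power_nonneg _ := ae_of_all _ fun _ => zero_le_one
  indep := by
    rw [iIndepFun_iff_measure_inter_preimage_eq_mul]
    intro S sets _
    by_cases hall : ∀ i ∈ S, ((1 : ℝ), (1 : ℝ)) ∈ sets i
    · rw [Finset.prod_eq_one fun i hi => by simp [hall i hi]]
      have : ⋂ i ∈ S, (fun _ : Ω => ((1 : ℝ), (1 : ℝ))) ⁻¹' sets i = univ :=
        Set.eq_univ_of_forall fun ω => mem_iInter₂.2 hall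
      rw [this, measure_univ]
    · push Not at hall
      obtain ⟨i, hi, hni⟩ := hall
      have he : (fun _ : Ω => ((1 : ℝ), (1 : ℝ))) ⁻¹' sets i = ∅ := by simp [hni]
      rw [Finset.prod_eq_zero hi (by rw [he, measure_empty])]
      exact measure_mono_null (iInter₂_subset i hi) (by rw [he, measure_empty])
  identDistrib _ := IdentDistrib.refl measurable_const.aemeasurable
  indep_distances := indepFun_const_right _ _

end

end ShotgunCellular

theorem theorem2 {Ω : Type*} [MeasurableSpace Ω] (P : Measure Ω) [IsProbabilityMeasure P]
    (ε : ℝ) (hε : 0 < ε)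
    (lam : ℝ → ℝ) (hlam_meas : Measurable lam) (hlam_nonneg : ∀ r, 0 ≤ r → 0 ≤ lam r)
    (R : ℕ → Ω → ℝ≥0∞) (Ψ K : ℕ → Ω → ℝ)
    (hS : ShotgunCellular.IsSCS P lam R Ψ K)
    (hconv : ∀ᵐ r ∂(volume.restrict (Ici (0 : ℝ))),
      Integrable (ShotgunCellular.densityIntegrand ε lam (Ψ 0) (K 0) r) P) :
    -- the distances `R i * (Ψ i * K i) ^ (-1/ε)` form a unit system with the modified density
    ShotgunCellular.IsSCS P (ShotgunCellular.modifiedDensity P ε lam (Ψ 0) (K 0))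
      (fun i ω => R i ω * ENNReal.ofReal (Ψ i ω * K i ω) ^ (-(1 / ε)))
      (fun _ _ => 1) (fun _ _ => 1) ∧
    -- every unit system with the modified density has the same distribution of C/I
    ∀ (Ω' : Type*) [MeasurableSpace Ω'] (P' : Measure Ω') [IsProbabilityMeasure P']
      (R' : ℕ → Ω' → ℝ≥0∞),
      ShotgunCellular.IsSCS P' (ShotgunCellular.modifiedDensity P ε lam (Ψ 0) (K 0)) R'
        (fun _ _ => 1) (fun _ _ => 1) →
      IdentDistrib (ShotgunCellular.carrierToInterference ε R Ψ K)
        (ShotgunCellular.carrierToInterference ε R' (fun _ _ => 1) (fun _ _ => 1)) P P' := by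
  have hscaled := hS.isPoisson_scaled hε hlam_meas hlam_nonneg hconv
  refine ⟨hscaled.isSCS_one, fun Ω' _ P' _ R' h' => ?_⟩
  have hident := hscaled.identDistrib_carrierToInterference hε h'.poisson
  -- Outside the null event that some distance is `0`, the original and the rescaled system have the
  -- same powers index by index, hence the same C/I.
  refine (ProbabilityTheory.IdentDistrib.of_ae_eq hident.aemeasurable_fst ?_).symm.trans hident
  filter_upwards [hS.poisson.ae_ne_zero] with ω hω
  simp only [ShotgunCellular.carrierToInterference,
    fun i => ShotgunCellular.receivedPower_scaled (Ψ := Ψ) (K := K) hε (hω i)]
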